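/- **Theorem.** Let $X\subset\mathbb P^n(\mathbb C)$ be a complex projective variety (irreducible, possibly singular) and let $D$ be an effective Cartier divisor on $X$; write $X\setminus D$ for the complement of the support of $D$. If $X\setminus D$ is hyperbolically imbedded in $X$, then $X\setminus D$ is quantitatively big Picard. Here the terms have the following meaning. * $X\setminus D$ is *hyperbolically imbedded* in $X$ if any two distinct points $p\ne q$ of the closure of $X\setminus D$ in $X$ have neighbourhoods $U_p,U_q$ in $X$ such that $d\big(U_p\cap (X\setminus D),\,U_q\cap (X\setminus D)\big)>0$, where $d$ is the Kobayashi pseudo-distance of $X\setminus D$. * For a positive (i.e. smooth and positive definite) $(1,1)$-form $\eta$ on $X$, a holomorphic map $f:\{z\in\mathbb C:|z|>r_0\}\to X$ with $r_0>0$, and $r_1>r_0$, put $$T_{f,\eta}(r,r_1)=\int_{r_1}^{r}\Big(\int_{r_1<|z|<t} f^*\eta\Big)\frac{dt}{t}\qquad (r>r_1).$$ * $X\setminus D$ is *quantitatively big Picard* if for every $r_0>0$ and every holomorphic map $f:\{z\in\mathbb C:|z|>r_0\}\to X\setminus D$ there exists a positive $(1,1)$-form $\eta$ on $X$ such that for every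 $r_1>r_0$ $$T_{f,\eta}(r,r_1)\le_{\rm exc} O(\log r),$$ i.e. there is a constant $C$ (depending on $f,\eta,r_0,r_1$) such that $T_{f,\eta}(r,r_1)\le C\log r$ for all $r>r_1$ outside a set of finite Lebesgue measure. -/

import Mathlib

open MeasureTheory Filter Topology Set
open scoped ENNReal ContDiff

/-! ### Complex projective space and projective varieties -/

/-- Complex projective space of dimension `n`. -/
abbrev CP (n : ℕ) : Type := Projectivization ℂ (Fin (n + 1) → ℂ)

/-- The Euclidean (analytic) topology of projective space: the quotient topology from
the nonzero vectors. -/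
noncomputable instance CP.instTopologicalSpace (n : ℕ) : TopologicalSpace (CP n) :=
  TopologicalSpace.coinduced
    (Projectivization.mk' ℂ : {v : Fin (n + 1) → ℂ // v ≠ 0} → CP n) inferInstance

/-- Zariski closed subsets of projective space: common zero sets of homogeneous polynomials. -/
def IsZariskiClosed {n : ℕ} (A : Set (CP n)) : Prop :=
  ∃ S : Set (MvPolynomial (Fin (n + 1)) ℂ),
    (∀ p ∈ S, ∃ d : ℕ, p.IsHomogeneous d) ∧
      A = {x : CP n | ∀ p ∈ S, MvPolynomial.eval x.rep p = 0}

/-- A (complex) projective variety: an irreducible Zariski closed subset of a projective space.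
It may be singular. -/
structure ProjectiveVariety (n : ℕ) where
  carrier : Set (CP n)
  closed : IsZariskiClosed carrier
  nonempty : carrier.Nonempty
  irreducible : ∀ A B : Set (CP n), IsZariskiClosed A → IsZariskiClosed B →
    carrier ⊆ A ∪ B → carrier ⊆ A ∨ carrier ⊆ B

namespace ProjectiveVariety

variable {n : ℕ} (X : ProjectiveVariety n)

/-- `V` is a Zariski open subset of the variety `X`. -/
def IsOpenIn (V : Set (CP n)) : Prop :=
  ∃ A : Set (CP n), IsZariskiClosed A ∧ V = X.carrier \ A

/-- `φ` is a regular function on the Zariski open subset `U` of `X`: near every point of `U` it is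
a quotient of two homogeneous polynomials of the same degree, with nowhere vanishing
denominator. -/
def IsRegularOn (U : Set (CP n)) (φ : CP n → ℂ) : Prop :=
  ∀ x ∈ U, ∃ V : Set (CP n), X.IsOpenIn V ∧ x ∈ V ∧ V ⊆ U ∧
    ∃ (d : ℕ) (g h : MvPolynomial (Fin (n + 1)) ℂ), g.IsHomogeneous d ∧ h.IsHomogeneous d ∧
      ∀ y ∈ V, MvPolynomial.eval y.rep h ≠ 0 ∧
        φ y = MvPolynomial.eval y.rep g / MvPolynomial.eval y.rep h

end ProjectiveVariety

/-- An effective Cartier divisor on the projective variety `X`, given by local equations: nonempty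
Zariski open sets `U i` covering `X`, and on each of them a nonzero regular function `f i` (a
nonzerodivisor, since `X` is integral), such that `f i` and `f j` differ by a nowhere vanishing
regular function on `U i ∩ U j`. -/
structure EffectiveCartierDivisor {n : ℕ} (X : ProjectiveVariety n) where
  ι : Type
  U : ι → Set (CP n)
  f : ι → CP n → ℂ
  isOpenIn : ∀ i, X.IsOpenIn (U i)
  cover : X.carrier ⊆ ⋃ i, U i
  regular : ∀ i, X.IsRegularOn (U i) (f i)
  nonzero : ∀ i, ∃ x ∈ U i, f i x ≠ 0
  compatible : ∀ i j, ∃ u : CP n → ℂ, X.IsRegularOn (U i ∩ U j) u ∧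
    ∀ x ∈ U i ∩ U j, u x ≠ 0 ∧ f i x = u x * f j x

/-- The support of an effective Cartier divisor: the common zero set of its local equations. -/
def EffectiveCartierDivisor.support {n : ℕ} {X : ProjectiveVariety n}
    (D : EffectiveCartierDivisor X) : Set (CP n) :=
  {x | ∃ i, x ∈ D.U i ∧ D.f i x = 0}

/-- The complement of the support of `D` in `X`. -/
def EffectiveCartierDivisor.compl {n : ℕ} {X : ProjectiveVariety n}
    (D : EffectiveCartierDivisor X) : Set (CP n) :=
  X.carrier \ D.support

/-! ### Holomorphic curves in projective space -/

/-- `F` is a holomorphic lift of `f` to `ℂ ^ (n + 1) \ {0}` in a neighbourhood of `z`. -/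
def IsLocalLift {n : ℕ} (f : ℂ → CP n) (z : ℂ) (F : ℂ → Fin (n + 1) → ℂ) : Prop :=
  AnalyticAt ℂ F z ∧ ∀ᶠ w in 𝓝 z, ∃ hw : F w ≠ 0, f w = Projectivization.mk ℂ (F w) hw

/-- `f` restricts to a holomorphic map from the open set `Ω` to the subset `Y` of projective
space: locally on `Ω` it has holomorphic homogeneous coordinates without common zeros, and it
takes values in `Y`. Values of `f` outside `Ω` play no role. -/
def IsHolomorphicInto {n : ℕ} (Ω : Set ℂ) (Y : Set (CP n)) (f : ℂ → CP n) : Prop :=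
  (∀ z ∈ Ω, ∃ F : ℂ → Fin (n + 1) → ℂ, IsLocalLift f z F) ∧ MapsTo f Ω Y

/-! ### The Kobayashi pseudo-distance and hyperbolic imbedding -/

/-- The Poincaré distance (of curvature `-1`) of two points of the open unit disk. -/
noncomputable def poincareDist (a b : ℂ) : ℝ :=
  Real.log ((1 + ‖(a - b) / (1 - (starRingEnd ℂ) a * b)‖) /
    (1 - ‖(a - b) / (1 - (starRingEnd ℂ) a * b)‖))

/-- The infimum of the Poincaré distances of `a` and `b`, over all holomorphic maps `g` from the
unit disk to `Y` and all points `a`, `b` of the disk with `g a = p` and `g b = q`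
(infinite if there are none). -/
noncomputable def oneDiskDist {n : ℕ} (Y : Set (CP n)) (p q : CP n) : ℝ≥0∞ :=
  ⨅ (g : ℂ → CP n) (a : ℂ) (b : ℂ)
    (_ : IsHolomorphicInto (Metric.ball 0 1) Y g ∧ a ∈ Metric.ball (0 : ℂ) 1 ∧
      b ∈ Metric.ball (0 : ℂ) 1 ∧ g a = p ∧ g b = q),
    ENNReal.ofReal (poincareDist a b)

/-- The Kobayashi pseudo-distance of `Y`: the infimum of the lengths of all finite chains of
holomorphic disks in `Y` joining `p` to `q`. -/
noncomputable def kobayashiDist {n : ℕ} (Y : Set (CP n)) (p q : CP n) : ℝ≥0∞ :=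
  ⨅ (k : ℕ) (c : ℕ → CP n) (_ : c 0 = p ∧ c k = q),
    ∑ i ∈ Finset.range k, oneDiskDist Y (c i) (c (i + 1))

/-- `Y` is hyperbolically imbedded in `X` (for `Y ⊆ X`, with `X` compact): any two distinct points
of the closure of `Y` in `X` have neighbourhoods in `X` whose traces on `Y` are at positive
Kobayashi distance in `Y`. -/
def HyperbolicallyImbedded {n : ℕ} (Y X : Set (CP n)) : Prop :=
  ∀ p ∈ X ∩ closure Y, ∀ q ∈ X ∩ closure Y, p ≠ q →
    ∃ U ∈ 𝓝[X] p, ∃ V ∈ 𝓝[X] q, ∃ ε : ℝ≥0∞, 0 < ε ∧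
      ∀ x ∈ U ∩ Y, ∀ y ∈ V ∩ Y, ε ≤ kobayashiDist Y x y

/-! ### Positive (1,1)-forms and the characteristic function -/

/-- A smooth positive (i.e. positive definite) `(1,1)`-form `η` on projective space, described
through its pullback `(√-1 / 2) ∑ H_jk(v) dv_k ∧ d(conj v_j)` to `ℂ ^ (n + 1) \ {0}`: the tangent
space at the point `[v]` is `ℂ ^ (n + 1) / ℂ v`, the tangent vector represented by `a` at `v` being
the one represented by `c a` at `c v`, so a smooth form on the nonzero vectors comes from
projective space if and only if it is horizontal and invariant under scaling.

By a partition of unity, the restrictions of these to a projective variety `X` are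
exactly the positive `(1,1)`-forms on `X`, i.e. the forms that are locally on `X` induced by
positive `(1,1)`-forms under local embeddings in smooth spaces. -/
structure PositiveForm (n : ℕ) where
  H : (Fin (n + 1) → ℂ) → Matrix (Fin (n + 1)) (Fin (n + 1)) ℂ
  smooth : ∀ j k, ContDiffOn ℝ ∞ (fun v => H v j k) {v | v ≠ 0}
  hermitian : ∀ v, v ≠ 0 → (H v).IsHermitian
  horizontal : ∀ v, v ≠ 0 → Matrix.mulVec (H v) v = 0
  scaling : ∀ v, v ≠ 0 → ∀ c : ℂ, c ≠ 0 → ((‖c‖ ^ 2 : ℝ) : ℂ) • H (c • v) = H v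
  positive : ∀ v, v ≠ 0 → ∀ a, a ∉ Submodule.span ℂ {v} →
    0 < (dotProduct (star a) (Matrix.mulVec (H v) a)).re

/-- The squared norm, for `η`, of the tangent vector at `[v]` represented by `a` at `v`. -/
noncomputable def PositiveForm.normSq {n : ℕ} (η : PositiveForm n) (v a : Fin (n + 1) → ℂ) : ℝ :=
  (dotProduct (star a) (Matrix.mulVec (η.H v) a)).re

open Classical in
/-- The density of `f^* η` with respect to `(√-1 / 2) dz ∧ d(conj z) = dx ∧ dy`: it is
`η.normSq (F z) (F' z)` for one, equivalently for every (see `pullbackDensity_eq`), holomorphic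
lift `F` of `f` near `z`. -/
noncomputable def PositiveForm.pullbackDensity {n : ℕ} (η : PositiveForm n) (f : ℂ → CP n)
    (z : ℂ) : ℝ :=
  if h : ∃ F : ℂ → Fin (n + 1) → ℂ, IsLocalLift f z F then
    η.normSq (h.choose z) (deriv h.choose z) else 0

theorem PositiveForm.normSq_smul_add {n : ℕ} (η : PositiveForm n) (v a : Fin (n + 1) → ℂ)
    (hv : v ≠ 0) (c d : ℂ) (hc : c ≠ 0) :
    η.normSq (c • v) (d • v + c • a) = η.normSq v a := by
  have hcv : c • v ≠ 0 := smul_ne_zero hc hv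
  have h1 : Matrix.mulVec (η.H (c • v)) v = 0 := by
    have := η.horizontal _ hcv
    rw [Matrix.mulVec_smul] at this
    exact (smul_eq_zero.1 this).resolve_left hc
  have h2 : Matrix.vecMul (star v) (η.H (c • v)) = 0 := by
    have h3 := congrArg star h1
    rw [Matrix.star_mulVec, (η.hermitian _ hcv).eq, star_zero] at h3
    exact h3
  unfold PositiveForm.normSq
  rw [← η.scaling v hv c hc]
  have h4 : star c * c = ((‖c‖ ^ 2 : ℝ) : ℂ) := by
    have := Complex.conj_mul' c
    simpa using this
  congr 1
  rw [Matrix.mulVec_add, Matrix.mulVec_smul, h1, smul_zero, zero_add, Matrix.dotProduct_mulVec,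
    star_add, Matrix.add_vecMul, star_smul, Matrix.smul_vecMul, h2, smul_zero, zero_add, star_smul,
    Matrix.smul_vecMul, smul_dotProduct, Matrix.smul_mulVec, dotProduct_smul, dotProduct_smul,
    Matrix.dotProduct_mulVec, ← h4, smul_smul]

/-- The density of `f^* η` may be computed with any local holomorphic lift. -/
theorem PositiveForm.pullbackDensity_eq {n : ℕ} (η : PositiveForm n) (f : ℂ → CP n) (z : ℂ)
    (F : ℂ → Fin (n + 1) → ℂ) (hF : IsLocalLift f z F) :
    η.pullbackDensity f z = η.normSq (F z) (deriv F z) := by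
  have h : ∃ F : ℂ → Fin (n + 1) → ℂ, IsLocalLift f z F := ⟨F, hF⟩
  unfold PositiveForm.pullbackDensity
  rw [dif_pos h]
  have hG := h.choose_spec
  generalize h.choose = G at hG
  obtain ⟨hFz, hFf⟩ := hF.2.self_of_nhds
  obtain ⟨i, hi⟩ : ∃ i, F z i ≠ 0 := Function.ne_iff.1 hFz
  have hFi : AnalyticAt ℂ (fun w => F w i) z :=
    ((ContinuousLinearMap.proj (R := ℂ) (φ := fun _ : Fin (n + 1) => ℂ) i).analyticAt _).comp hF.1
  have hGi : AnalyticAt ℂ (fun w => G w i) z :=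
    ((ContinuousLinearMap.proj (R := ℂ) (φ := fun _ : Fin (n + 1) => ℂ) i).analyticAt _).comp hG.1
  have hc : AnalyticAt ℂ (fun w => G w i / F w i) z := hGi.div hFi hi
  have hne : ∀ᶠ w in 𝓝 z, F w i ≠ 0 := hFi.continuousAt.eventually_ne hi
  have key : ∀ᶠ w in 𝓝 z, G w = (G w i / F w i) • F w ∧ G w i / F w i ≠ 0 := by
    filter_upwards [hne, hF.2, hG.2] with w hw ⟨h1, h1'⟩ ⟨h2, h2'⟩
    rw [h1', Projectivization.mk_eq_mk_iff] at h2'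
    obtain ⟨u, hu⟩ := h2'
    have hui : (u : ℂ) * G w i = F w i := by
      have := congrFun hu i
      simpa [Units.smul_def] using this
    have hGw : G w i ≠ 0 := by
      intro h0; rw [h0, mul_zero] at hui; exact hw hui.symm
    refine ⟨?_, div_ne_zero hGw hw⟩
    have : F w = (u : ℂ) • G w := hu.symm
    rw [this]
    funext j
    simp only [Pi.smul_apply, smul_eq_mul]
    field_simp [u.ne_zero]
  have hEq : G =ᶠ[𝓝 z] fun w => (G w i / F w i) • F w := key.mono fun w hw => hw.1
  have hd : deriv G z = deriv (fun w => G w i / F w i) z • F z + (G z i / F z i) • deriv F z := by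
    have h5 := (hc.differentiableAt.hasDerivAt.smul hF.1.differentiableAt.hasDerivAt).deriv
    rw [hEq.deriv_eq]
    refine Eq.trans h5 (add_comm _ _)
  obtain ⟨k1, k2⟩ := key.self_of_nhds
  have := η.normSq_smul_add (F z) (deriv F z) hFz (G z i / F z i)
    (deriv (fun w => G w i / F w i) z) k2
  rw [← k1, ← hd] at this
  exact this

/-- The Nevanlinna characteristic function
`T_{f,η}(r, r₁) = ∫_{r₁}^r (∫_{r₁ < |z| < t} f^* η) dt / t`
(the integrands are nonnegative, so it is taken as an extended nonnegative number). -/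
noncomputable def characteristicFn {n : ℕ} (η : PositiveForm n) (f : ℂ → CP n) (r r₁ : ℝ) :
    ℝ≥0∞ :=
  ∫⁻ t in Ioo r₁ r,
    (∫⁻ z in {z : ℂ | r₁ < ‖z‖ ∧ ‖z‖ < t}, ENNReal.ofReal (η.pullbackDensity f z)) /
      ENNReal.ofReal t

/-- `T(r) ≤ O(log r)` for all `r > r₁` outside an exceptional set of finite Lebesgue measure. -/
def LeExcBigOLog (T : ℝ → ℝ≥0∞) (r₁ : ℝ) : Prop :=
  ∃ C : ℝ, volume {r : ℝ | r₁ < r ∧ ¬ T r ≤ ENNReal.ofReal (C * Real.log r)} ≠ ⊤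

/-- A map `f`, to be holomorphic on the complement of the closed disk of radius `r₀` about `0`,
has the quantitative big Picard property. -/
def HasQuantitativeBigPicardProperty {n : ℕ} (r₀ : ℝ) (f : ℂ → CP n) : Prop :=
  ∃ η : PositiveForm n, ∀ r₁ : ℝ, r₀ < r₁ → LeExcBigOLog (fun r => characteristicFn η f r r₁) r₁

/-- The complement of `D` in `X` is quantitatively big Picard. -/
def QuantitativelyBigPicard {n : ℕ} {X : ProjectiveVariety n} (D : EffectiveCartierDivisor X) :
    Prop :=
  ∀ (r₀ : ℝ), 0 < r₀ → ∀ f : ℂ → CP n, IsHolomorphicInto {z : ℂ | r₀ < ‖z‖} D.compl f →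
    HasQuantitativeBigPicardProperty r₀ f

/-! ### Topology of projective space -/

/-! Hyperbolic imbedding makes holomorphic disks in `Y = X \ D` equicontinuous at the centre. If
arbitrarily small disks around 0 were mapped outside every chart, then along an ultrafilter the
images of 0 and of points tending to 0 would converge to distinct points of the closure of `Y`,
while their Kobayashi distance, at most the Poincaré distance in the disk, tends to 0. Hence a disk
of uniform radius lands in one bounded affine chart
(`HyperbolicallyImbedded.exists_mapsTo_chartDomain`), and Cauchy's estimate bounds the Fubini-Study
derivative at 0 by a constant (`HyperbolicallyImbedded.exists_pullbackDensity_le`).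

For a curve `f` on `|z| > r₀`, precomposing with the universal covering of this domain by the disk,
centred at `z`, turns that constant into a bound for the density of `f^* η` by a multiple of the
Poincaré density `1 / (|z| log (|z| / r₀))²`
(`HyperbolicallyImbedded.exists_pullbackDensity_le_exterior`). The Poincaré area of `|z| > r₁` is
finite for `r₁ > r₀` (`lintegral_poincare_exterior_lt_top`), so the inner integral of the
characteristic function is bounded by some `K`, and the outer one contributes only `K log (r / r₁)`.
-/

theorem CP.continuous_mk' (n : ℕ) :
    Continuous (Projectivization.mk' ℂ : {v : Fin (n + 1) → ℂ // v ≠ 0} → CP n) :=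
  continuous_coinduced_rng

instance CP.instCompactSpace (n : ℕ) : CompactSpace (CP n) := by
  have hne (v : Metric.sphere (0 : Fin (n + 1) → ℂ) 1) : (v : Fin (n + 1) → ℂ) ≠ 0 :=
    ne_zero_of_mem_unit_sphere v
  let φ : Metric.sphere (0 : Fin (n + 1) → ℂ) 1 → CP n := fun v =>
    Projectivization.mk' ℂ ⟨v, hne v⟩
  have hφ : Continuous φ :=
    (CP.continuous_mk' n).comp (continuous_subtype_val.subtype_mk hne)
  have hsurj : Function.Surjective φ := by
    intro x
    have hx : ‖x.rep‖ ≠ 0 := norm_ne_zero_iff.2 x.rep_nonzero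
    refine ⟨⟨((‖x.rep‖⁻¹ : ℝ) : ℂ) • x.rep, ?_⟩, ?_⟩
    · rw [mem_sphere_zero_iff_norm, norm_smul, Complex.norm_real, norm_inv, norm_norm,
        inv_mul_cancel₀ hx]
    · conv_rhs => rw [← x.mk_rep]
      refine (Projectivization.mk_eq_mk_iff' ℂ _ _ _ _).2 ⟨((‖x.rep‖⁻¹ : ℝ) : ℂ), rfl⟩
  exact hsurj.compactSpace hφ

theorem MvPolynomial.IsHomogeneous.eval_smul_eq {σ R : Type*} [CommSemiring R]
    {p : MvPolynomial σ R} {d : ℕ} (hp : p.IsHomogeneous d) (c : R) (v : σ → R) :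
    MvPolynomial.eval (c • v) p = c ^ d * MvPolynomial.eval v p := by
  rw [MvPolynomial.eval_eq, MvPolynomial.eval_eq, Finset.mul_sum]
  refine Finset.sum_congr rfl fun m hm => ?_
  have hd : ∑ i ∈ m.support, m i = d := by
    simpa [Finsupp.weight_apply, Finsupp.sum] using hp (MvPolynomial.mem_support_iff.1 hm)
  simp only [Pi.smul_apply, smul_eq_mul, mul_pow, Finset.prod_mul_distrib,
    Finset.prod_pow_eq_pow_sum, hd]
  ring

/-- Homogeneity makes vanishing independent of the representative, so the preimage in the nonzero
vectors is a common zero set of continuous functions. -/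
theorem IsZariskiClosed.isClosed {n : ℕ} {A : Set (CP n)} (hA : IsZariskiClosed A) :
    IsClosed A := by
  obtain ⟨S, hS, rfl⟩ := hA
  rw [isClosed_coinduced]
  have h : (Projectivization.mk' ℂ : {v : Fin (n + 1) → ℂ // v ≠ 0} → CP n) ⁻¹'
      {x : CP n | ∀ p ∈ S, MvPolynomial.eval x.rep p = 0} =
      ⋂ p ∈ S, {v | MvPolynomial.eval v.1 p = 0} := by
    ext v
    simp only [mem_preimage, mem_ofPred_eq, mem_iInter]
    refine forall₂_congr fun p hp => ?_
    obtain ⟨d, hd⟩ := hS p hp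
    obtain ⟨a, ha⟩ := Projectivization.exists_smul_eq_mk_rep ℂ v.1 v.2
    have hrep : (Projectivization.mk' ℂ v).rep = (a : ℂ) • v.1 := ha.symm
    rw [hrep, hd.eval_smul_eq]
    simp
  rw [h]
  refine isClosed_biInter fun p _ => isClosed_eq ?_ continuous_const
  exact (MvPolynomial.continuous_eval p).comp continuous_subtype_val

/-- The points whose `i`-th homogeneous coordinate has more than half the absolute value of every
coordinate. -/
def CP.chartDomain {n : ℕ} (i : Fin (n + 1)) : Set (CP n) :=
  {x | ∀ j, ‖x.rep j‖ < 2 * ‖x.rep i‖}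

theorem CP.mk_mem_chartDomain {n : ℕ} (i : Fin (n + 1)) (v : Fin (n + 1) → ℂ) (hv : v ≠ 0) :
    (Projectivization.mk ℂ v hv : CP n) ∈ CP.chartDomain i ↔ ∀ j, ‖v j‖ < 2 * ‖v i‖ := by
  obtain ⟨a, ha⟩ := Projectivization.exists_smul_eq_mk_rep ℂ v hv
  have h0 : 0 < ‖(a : ℂ)‖ := norm_pos_iff.2 a.ne_zero
  refine forall_congr' fun j => ?_
  rw [← ha]
  simp only [Units.smul_def, Pi.smul_apply, smul_eq_mul, norm_mul]
  rw [mul_left_comm, mul_lt_mul_iff_right₀ h0]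

theorem CP.isOpen_chartDomain {n : ℕ} (i : Fin (n + 1)) : IsOpen (CP.chartDomain i) := by
  rw [isOpen_coinduced]
  have h : (Projectivization.mk' ℂ : {v : Fin (n + 1) → ℂ // v ≠ 0} → CP n) ⁻¹'
      CP.chartDomain i = ⋂ j, {v | ‖v.1 j‖ < 2 * ‖v.1 i‖} := by
    ext v
    simp only [mem_preimage, mem_iInter, mem_ofPred_eq]
    exact CP.mk_mem_chartDomain i v.1 v.2
  rw [h]
  refine isOpen_iInter_of_finite fun j => isOpen_lt ?_ ?_
  · exact ((continuous_apply j).comp continuous_subtype_val).norm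
  · exact (((continuous_apply i).comp continuous_subtype_val).norm).const_mul 2

/-- A coordinate of largest absolute value works. The factor 2 in the definition allows a strict
inequality, hence an open domain, while the affine coordinates stay bounded by 2. -/
theorem CP.exists_mem_chartDomain {n : ℕ} (x : CP n) : ∃ i, x ∈ CP.chartDomain i := by
  obtain ⟨i, hi⟩ := Finite.exists_max fun j => ‖x.rep j‖
  refine ⟨i, fun j => ?_⟩
  have : 0 < ‖x.rep i‖ := by
    refine lt_of_le_of_ne (norm_nonneg _) fun h => x.rep_nonzero ?_
    funext j
    exact norm_le_zero_iff.1 ((hi j).trans h.symm.le)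
  linarith [hi j]

/-! ### The Fubini-Study form -/

/-- The squared Euclidean norm. -/
noncomputable def sqNorm {m : ℕ} (v : Fin m → ℂ) : ℝ := ∑ i, ‖v i‖ ^ 2

theorem star_dotProduct_self {m : ℕ} (v : Fin m → ℂ) : dotProduct (star v) v = (sqNorm v : ℂ) := by
  simp [dotProduct, sqNorm, Complex.conj_mul']

theorem sqNorm_nonneg {m : ℕ} (v : Fin m → ℂ) : 0 ≤ sqNorm v :=
  Finset.sum_nonneg fun _ _ => by positivity

theorem sqNorm_pos {m : ℕ} {v : Fin m → ℂ} (hv : v ≠ 0) : 0 < sqNorm v := by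
  obtain ⟨i, hi⟩ := Function.ne_iff.1 hv
  refine Finset.sum_pos' (fun _ _ => by positivity) ⟨i, Finset.mem_univ _, ?_⟩
  have : 0 < ‖v i‖ := norm_pos_iff.2 hi
  positivity

theorem sqNorm_smul {m : ℕ} (c : ℂ) (v : Fin m → ℂ) : sqNorm (c • v) = ‖c‖ ^ 2 * sqNorm v := by
  simp [sqNorm, mul_pow, Finset.mul_sum]

/-- The matrix of the Fubini-Study form. -/
noncomputable def fubiniStudyMatrix {m : ℕ} (v : Fin m → ℂ) : Matrix (Fin m) (Fin m) ℂ :=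
  ((sqNorm v)⁻¹ : ℂ) • 1 - (((sqNorm v) ^ 2)⁻¹ : ℂ) • Matrix.vecMulVec v (star v)

theorem fubiniStudyMatrix_mulVec {m : ℕ} (v a : Fin m → ℂ) :
    Matrix.mulVec (fubiniStudyMatrix v) a =
      ((sqNorm v)⁻¹ : ℂ) • a - ((((sqNorm v) ^ 2)⁻¹ : ℂ) * dotProduct (star v) a) • v := by
  rw [fubiniStudyMatrix, Matrix.sub_mulVec, Matrix.smul_mulVec, Matrix.one_mulVec,
    Matrix.smul_mulVec, Matrix.vecMulVec_mulVec, mul_smul]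
  simp

theorem contDiff_sqNorm {m : ℕ} : ContDiff ℝ ∞ (sqNorm : (Fin m → ℂ) → ℝ) := by
  unfold sqNorm
  refine ContDiff.sum fun i _ => ?_
  exact (contDiff_norm_sq ℝ).comp (contDiff_apply ℝ ℂ i)

theorem fubiniStudy_re {m : ℕ} (v a : Fin m → ℂ) :
    (dotProduct (star a) (Matrix.mulVec (fubiniStudyMatrix v) a)).re =
      sqNorm a / sqNorm v - ‖dotProduct (star v) a‖ ^ 2 / sqNorm v ^ 2 := by
  have h1 : dotProduct (star a) v = star (dotProduct (star v) a) :=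
    Matrix.star_dotProduct _ _
  have h : dotProduct (star a) (Matrix.mulVec (fubiniStudyMatrix v) a) =
      ((sqNorm a / sqNorm v - ‖dotProduct (star v) a‖ ^ 2 / sqNorm v ^ 2 : ℝ) : ℂ) := by
    rw [fubiniStudyMatrix_mulVec, dotProduct_sub, dotProduct_smul, dotProduct_smul,
      star_dotProduct_self, h1]
    have h2 := Complex.mul_conj' (dotProduct (star v) a)
    simp only [smul_eq_mul, Complex.star_def]
    push_cast
    rw [← h2]
    ring
  rw [h, Complex.ofReal_re]

/-- The Fubini-Study form. -/
noncomputable def fubiniStudy (n : ℕ) : PositiveForm n where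
  H := fubiniStudyMatrix
  smooth := by
    intro j k v hv
    refine ContDiffAt.contDiffWithinAt ?_
    have hs : ContDiffAt ℝ ∞ (fun v : Fin (n + 1) → ℂ => (sqNorm v : ℂ)) v :=
      (Complex.ofRealCLM.contDiff.comp contDiff_sqNorm).contDiffAt
    have hv0 : (sqNorm v : ℂ) ≠ 0 := Complex.ofReal_ne_zero.2 (sqNorm_pos hv).ne'
    have hj : ContDiffAt ℝ ∞ (fun v : Fin (n + 1) → ℂ => v j) v :=
      (contDiff_apply ℝ ℂ j).contDiffAt
    have hk : ContDiffAt ℝ ∞ (fun v : Fin (n + 1) → ℂ => star (v k)) v :=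
      (Complex.conjCLE.contDiff.comp (contDiff_apply ℝ ℂ k)).contDiffAt
    have h := ((hs.inv hv0).mul (contDiffAt_const (c := (1 : Matrix _ _ ℂ) j k))).sub
      (((hs.pow 2).inv (pow_ne_zero 2 hv0)).mul (hj.mul hk))
    refine h.congr_of_eventuallyEq (Eventually.of_forall fun w => ?_)
    simp [fubiniStudyMatrix, Matrix.vecMulVec_apply]
  hermitian := by
    intro v _
    ext j k
    simp only [fubiniStudyMatrix, Matrix.conjTranspose_apply, Matrix.sub_apply, Matrix.smul_apply,
      Matrix.vecMulVec_apply, Matrix.one_apply, smul_eq_mul, star_sub, star_mul', Pi.star_apply,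
      Complex.star_def, map_inv₀, map_pow, Complex.conj_ofReal, eq_comm (a := k)]
    split_ifs <;> simp [mul_comm]
  horizontal := by
    intro v hv
    have hv0 : (sqNorm v : ℂ) ≠ 0 := Complex.ofReal_ne_zero.2 (sqNorm_pos hv).ne'
    rw [fubiniStudyMatrix_mulVec, star_dotProduct_self, ← sub_smul]
    convert zero_smul ℂ v using 2
    field_simp
    ring
  scaling := by
    intro v hv c hc
    have hv0 : (sqNorm v : ℂ) ≠ 0 := Complex.ofReal_ne_zero.2 (sqNorm_pos hv).ne'
    have hc0 : (‖c‖ : ℂ) ≠ 0 := Complex.ofReal_ne_zero.2 (norm_ne_zero_iff.2 hc)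
    have h1 := Complex.mul_conj' c
    ext j k
    simp only [fubiniStudyMatrix, Matrix.sub_apply, Matrix.smul_apply, Matrix.vecMulVec_apply,
      sqNorm_smul, smul_eq_mul, Pi.smul_apply, Pi.star_apply, star_mul', Complex.star_def]
    push_cast
    rw [show c * v j * ((starRingEnd ℂ) c * (starRingEnd ℂ) (v k)) =
      (c * (starRingEnd ℂ) c) * (v j * (starRingEnd ℂ) (v k)) by ring, h1]
    field_simp
  positive := by
    intro v hv a ha
    have hs := sqNorm_pos hv
    have hs0 : (sqNorm v : ℂ) ≠ 0 := Complex.ofReal_ne_zero.2 hs.ne'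
    -- `l • v` is the orthogonal projection of `a` onto the line of `v`; the form equals the squared
    -- norm of `a - l • v` divided by that of `v`.
    set l : ℂ := dotProduct (star v) a / sqNorm v with hl
    have hb : a - l • v ≠ 0 := fun h =>
      ha (Submodule.mem_span_singleton.2 ⟨l, (sub_eq_zero.1 h).symm⟩)
    have hpos := sqNorm_pos hb
    have h1 : dotProduct (star a) v = star (dotProduct (star v) a) :=
      Matrix.star_dotProduct _ _
    have h3 := star_dotProduct_self (a - l • v)
    rw [star_sub, star_smul, sub_dotProduct, dotProduct_sub, dotProduct_sub, smul_dotProduct,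
      smul_dotProduct, dotProduct_smul, dotProduct_smul, star_dotProduct_self,
      star_dotProduct_self, h1] at h3
    have h2 := Complex.mul_conj' (dotProduct (star v) a)
    have h4 : (sqNorm (a - l • v) : ℂ) =
        ((sqNorm a - ‖dotProduct (star v) a‖ ^ 2 / sqNorm v : ℝ) : ℂ) := by
      rw [← h3, hl]
      simp only [smul_eq_mul, Complex.star_def, map_div₀, Complex.conj_ofReal]
      push_cast
      rw [← h2]
      field_simp
      ring
    rw [fubiniStudy_re v a]
    rw [Complex.ofReal_inj.1 h4] at hpos
    have := div_pos hpos hs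
    calc (0 : ℝ) < _ := this
      _ = _ := by field_simp

theorem fubiniStudy_normSq_le {n : ℕ} (v a : Fin (n + 1) → ℂ) :
    (fubiniStudy n).normSq v a ≤ sqNorm a / sqNorm v := by
  refine (fubiniStudy_re v a).le.trans (sub_le_self _ ?_)
  positivity

/-! ### Holomorphic disks in hyperbolically imbedded sets -/

theorem kobayashiDist_le_oneDiskDist {n : ℕ} (Y : Set (CP n)) (p q : CP n) :
    kobayashiDist Y p q ≤ oneDiskDist Y p q := by
  refine (iInf_le_of_le 1 (iInf_le_of_le (fun k => if k = 0 then p else q)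
    (iInf_le_of_le (by simp) ?_)))
  simp

theorem kobayashiDist_le_poincareDist {n : ℕ} {Y : Set (CP n)} {g : ℂ → CP n}
    (hg : IsHolomorphicInto (Metric.ball 0 1) Y g) {a b : ℂ} (ha : a ∈ Metric.ball (0 : ℂ) 1)
    (hb : b ∈ Metric.ball (0 : ℂ) 1) :
    kobayashiDist Y (g a) (g b) ≤ ENNReal.ofReal (poincareDist a b) :=
  (kobayashiDist_le_oneDiskDist Y _ _).trans
    (iInf_le_of_le g (iInf_le_of_le a (iInf_le_of_le b
      (iInf_le_of_le ⟨hg, ha, hb, rfl, rfl⟩ le_rfl))))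

theorem tendsto_poincareDist_zero {ι : Type*} {l : Filter ι} {z : ι → ℂ}
    (hz : Tendsto z l (𝓝 0)) : Tendsto (fun k => poincareDist 0 (z k)) l (𝓝 0) := by
  have h : ContinuousAt (fun z : ℂ => Real.log ((1 + ‖z‖) / (1 - ‖z‖))) 0 := by
    refine ContinuousAt.log ?_ (by simp)
    exact ContinuousAt.div (by fun_prop) (by fun_prop) (by simp)
  have h2 := h.tendsto.comp hz
  simpa [Function.comp_def, poincareDist] using h2

/-- Holomorphic disks in a hyperbolically imbedded set map a disk of uniform size around the
origin into one of the standard charts. -/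
theorem HyperbolicallyImbedded.exists_mapsTo_chartDomain {n : ℕ} {X Y : Set (CP n)}
    (hX : IsClosed X) (hYX : Y ⊆ X) (hY : HyperbolicallyImbedded Y X) :
    ∃ r : ℝ, 0 < r ∧ r < 1 ∧ ∀ g : ℂ → CP n, IsHolomorphicInto (Metric.ball 0 1) Y g →
      ∃ i, MapsTo g (Metric.ball 0 r) (CP.chartDomain i) := by
  by_contra! hcon
  have hr (k : ℕ) : 0 < 1 / ((k : ℝ) + 2) ∧ 1 / ((k : ℝ) + 2) < 1 := by
    refine ⟨by positivity, ?_⟩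
    rw [div_lt_one (by positivity)]
    linarith [k.cast_nonneg (α := ℝ)]
  choose g hg hgi using fun k : ℕ => hcon (1 / ((k : ℝ) + 2)) (hr k).1 (hr k).2
  have hzi (k : ℕ) (i : Fin (n + 1)) :
      ∃ z ∈ Metric.ball (0 : ℂ) (1 / ((k : ℝ) + 2)), g k z ∉ CP.chartDomain i := by
    simpa [MapsTo] using hgi k i
  -- An escaping point is kept for every chart index, since the relevant index is known only once
  -- the limit `p` is.
  choose z hz hzn using hzi
  have hball (k : ℕ) (i : Fin (n + 1)) : z k i ∈ Metric.ball (0 : ℂ) 1 :=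
    Metric.ball_subset_ball (hr k).2.le (hz k i)
  -- In a compact space every sequence converges along an ultrafilter, which replaces the passage to
  -- subsequences.
  have hlim (u : ℕ → CP n) (hu : ∀ k, u k ∈ Y) :
      ∃ p ∈ X ∩ closure Y, Tendsto u (hyperfilter ℕ) (𝓝[X] p) := by
    obtain ⟨p, -, hp⟩ := isCompact_univ.ultrafilter_le_nhds ((hyperfilter ℕ).map u) (by simp)
    have hp : Tendsto u (hyperfilter ℕ) (𝓝 p) := hp
    refine ⟨p, ⟨hX.mem_of_tendsto hp (Eventually.of_forall fun k => hYX (hu k)),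
      mem_closure_of_tendsto hp (Eventually.of_forall hu)⟩, ?_⟩
    exact tendsto_nhdsWithin_iff.2 ⟨hp, Eventually.of_forall fun k => hYX (hu k)⟩
  have h0 : (0 : ℂ) ∈ Metric.ball (0 : ℂ) 1 := by simp
  obtain ⟨p, hpX, hp⟩ := hlim (fun k => g k 0) fun k => (hg k).2 h0
  obtain ⟨i, hi⟩ := CP.exists_mem_chartDomain p
  obtain ⟨q, hqX, hq⟩ := hlim (fun k => g k (z k i)) fun k => (hg k).2 (hball k i)
  have hqi : q ∉ CP.chartDomain i :=
    (CP.isOpen_chartDomain i).isClosed_compl.mem_of_tendsto (hq.mono_right nhdsWithin_le_nhds)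
      (Eventually.of_forall fun k => hzn k i)
  -- The open chart contains `p`, and its closed complement contains `q`.
  have hpq : p ≠ q := fun h => hqi (h ▸ hi)
  obtain ⟨U, hU, V, hV, ε, hε, hUV⟩ := hY p hpX q hqX hpq
  have hz0 : Tendsto (fun k => z k i) (hyperfilter ℕ) (𝓝 0) := by
    refine Tendsto.mono_left ?_ Nat.hyperfilter_le_atTop
    refine squeeze_zero_norm (a := fun k : ℕ => 1 / ((k : ℝ) + 2))
      (fun k => (mem_ball_zero_iff.1 (hz k i)).le) ?_
    exact tendsto_const_nhds.div_atTop
      (tendsto_atTop_add_const_right _ _ tendsto_natCast_atTop_atTop)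
  have hd : Tendsto (fun k => ENNReal.ofReal (poincareDist 0 (z k i))) (hyperfilter ℕ) (𝓝 0) := by
    have := ENNReal.tendsto_ofReal (tendsto_poincareDist_zero hz0)
    rwa [ENNReal.ofReal_zero] at this
  obtain ⟨k, ⟨hkU, hkV⟩, hk⟩ :=
    (((hp.eventually_mem hU).and (hq.eventually_mem hV)).and (hd.eventually_lt_const hε)).exists
  exact (hUV _ ⟨hkU, (hg k).2 h0⟩ _ ⟨hkV, (hg k).2 (hball k i)⟩).not_gt
    ((kobayashiDist_le_poincareDist (hg k) h0 (hball k i)).trans_lt hk)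

/-! ### Derivative estimates -/

theorem IsLocalLift.apply_ne_zero {n : ℕ} {f : ℂ → CP n} {z : ℂ} {F : ℂ → Fin (n + 1) → ℂ}
    (hF : IsLocalLift f z F) {i : Fin (n + 1)} (hi : f z ∈ CP.chartDomain i) (j : Fin (n + 1)) :
    F z i ≠ 0 ∧ ‖F z j / F z i‖ ≤ 2 := by
  obtain ⟨h0, h⟩ := hF.2.self_of_nhds
  rw [h, CP.mk_mem_chartDomain] at hi
  have h1 : 0 < ‖F z i‖ := by linarith [hi j, norm_nonneg (F z j), hi i]
  exact ⟨norm_pos_iff.1 h1, by rw [norm_div, div_le_iff₀ h1]; exact (hi j).le⟩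

/-- The affine coordinates of a holomorphic curve form a local lift. -/
theorem exists_isLocalLift_chartDomain {n : ℕ} {f : ℂ → CP n} {Ω : Set ℂ}
    (hf : ∀ z ∈ Ω, ∃ F : ℂ → Fin (n + 1) → ℂ, IsLocalLift f z F) {i : Fin (n + 1)}
    (hi : MapsTo f Ω (CP.chartDomain i)) :
    ∃ G : ℂ → Fin (n + 1) → ℂ, ∀ z ∈ Ω, IsLocalLift f z G ∧ G z i = 1 ∧ ∀ j, ‖G z j‖ ≤ 2 := by
  -- These quotients do not depend on the representative, so near each point they agree with `F j /
  -- F i` for any local lift `F`; this gives analyticity.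
  refine ⟨fun z j => (f z).rep j / (f z).rep i, fun z hz => ?_⟩
  obtain ⟨F, hF⟩ := hf z hz
  have hrep (w : ℂ) (hw0 : F w ≠ 0) (hw : f w = Projectivization.mk ℂ (F w) hw0) :
      (fun j => (f w).rep j / (f w).rep i) = (F w i)⁻¹ • F w := by
    obtain ⟨a, ha⟩ := Projectivization.exists_smul_eq_mk_rep ℂ (F w) hw0
    funext j
    rw [hw, ← ha]
    simp only [Units.smul_def, Pi.smul_apply, smul_eq_mul]
    rw [mul_div_mul_left _ _ a.ne_zero, div_eq_inv_mul]
  have hFi : AnalyticAt ℂ (fun w => F w i) z :=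
    ((ContinuousLinearMap.proj (R := ℂ) (φ := fun _ : Fin (n + 1) => ℂ) i).analyticAt _).comp hF.1
  have hz0 := fun j => hF.apply_ne_zero (hi hz) j
  obtain ⟨hFz, hfz⟩ := hF.2.self_of_nhds
  refine ⟨⟨?_, ?_⟩, ?_, fun j => ?_⟩
  · refine ((hFi.inv (hz0 i).1).smul hF.1).congr ?_
    filter_upwards [hF.2] with w ⟨hw0, hw⟩
    exact (hrep w hw0 hw).symm
  · filter_upwards [hF.2, hFi.continuousAt.eventually_ne (hz0 i).1] with w ⟨hw0, hw⟩ hwi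
    have h1 : (F w i)⁻¹ • F w ≠ 0 := smul_ne_zero (inv_ne_zero hwi) hw0
    have h2 := hrep w hw0 hw
    simp only [h2]
    refine ⟨h1, hw.trans ?_⟩
    exact (Projectivization.mk_eq_mk_iff' ℂ _ _ _ _).2 ⟨F w i, smul_inv_smul₀ hwi _⟩
  · have := congrFun (hrep z hFz hfz) i
    simpa [(hz0 i).1] using this
  · have := congrFun (hrep z hFz hfz) j
    rw [Pi.smul_apply, smul_eq_mul, ← div_eq_inv_mul] at this
    exact (congrArg norm this).trans_le (hz0 j).2

theorem HyperbolicallyImbedded.exists_pullbackDensity_le {n : ℕ} {X Y : Set (CP n)}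
    (hX : IsClosed X) (hYX : Y ⊆ X) (hY : HyperbolicallyImbedded Y X) :
    ∃ C : ℝ, 0 ≤ C ∧ ∀ g : ℂ → CP n, IsHolomorphicInto (Metric.ball 0 1) Y g →
      (fubiniStudy n).pullbackDensity g 0 ≤ C := by
  obtain ⟨r, hr0, hr1, h⟩ := hY.exists_mapsTo_chartDomain hX hYX
  -- Cauchy's estimate on the circle of radius `r / 2` for coordinates bounded by 2, summed over the
  -- `n + 1` coordinates.
  refine ⟨(n + 1) * (2 / (r / 2)) ^ 2, by positivity, fun g hg => ?_⟩
  obtain ⟨i, hi⟩ := h g hg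
  obtain ⟨G, hG⟩ := exists_isLocalLift_chartDomain
    (fun z hz => hg.1 z (Metric.ball_subset_ball hr1.le hz)) hi
  have h0 := hG 0 (Metric.mem_ball_self hr0)
  rw [PositiveForm.pullbackDensity_eq _ _ _ _ h0.1]
  refine (fubiniStudy_normSq_le _ _).trans ?_
  have h1 : 1 ≤ sqNorm (G 0) := by
    have := Finset.single_le_sum (f := fun j => ‖G 0 j‖ ^ 2) (fun _ _ => by positivity)
      (Finset.mem_univ i)
    simpa [h0.2.1, sqNorm] using this
  refine (div_le_self (sqNorm_nonneg _) h1).trans ?_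
  have hderiv : ‖deriv G 0‖ ≤ 2 / (r / 2) := by
    have hsub : Metric.closedBall (0 : ℂ) (r / 2) ⊆ Metric.ball 0 r :=
      Metric.closedBall_subset_ball (by linarith)
    refine Complex.norm_deriv_le_of_forall_mem_sphere_norm_le (by positivity) ?_ fun z hz => ?_
    · refine DifferentiableOn.diffContOnCl fun z hz => ?_
      exact (hG z (hsub (Metric.closure_ball_subset_closedBall hz))).1.1.differentiableAt
        |>.differentiableWithinAt
    · exact (pi_norm_le_iff_of_nonneg zero_le_two).2
        (hG z (hsub (Metric.sphere_subset_closedBall hz))).2.2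
  calc sqNorm (deriv G 0) ≤ ∑ _j : Fin (n + 1), (2 / (r / 2)) ^ 2 := by
        refine Finset.sum_le_sum fun j _ => ?_
        exact pow_le_pow_left₀ (norm_nonneg _) ((norm_le_pi_norm _ j).trans hderiv) 2
    _ = _ := by simp

theorem IsLocalLift.comp {n : ℕ} {f : ℂ → CP n} {h : ℂ → ℂ} {z : ℂ} {F : ℂ → Fin (n + 1) → ℂ}
    (hF : IsLocalLift f (h z) F) (hh : AnalyticAt ℂ h z) : IsLocalLift (f ∘ h) z (F ∘ h) :=
  ⟨hF.1.comp hh, hh.continuousAt.eventually hF.2⟩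

theorem IsHolomorphicInto.comp {n : ℕ} {f : ℂ → CP n} {h : ℂ → ℂ} {Ω Ω' : Set ℂ} {Y : Set (CP n)}
    (hf : IsHolomorphicInto Ω Y f) (hh : ∀ z ∈ Ω', AnalyticAt ℂ h z) (hm : MapsTo h Ω' Ω) :
    IsHolomorphicInto Ω' Y (f ∘ h) := by
  refine ⟨fun z hz => ?_, hf.2.comp hm⟩
  obtain ⟨F, hF⟩ := hf.1 _ (hm hz)
  exact ⟨_, hF.comp (hh z hz)⟩

theorem PositiveForm.normSq_smul_right {n : ℕ} (η : PositiveForm n) (v a : Fin (n + 1) → ℂ)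
    (c : ℂ) : η.normSq v (c • a) = ‖c‖ ^ 2 * η.normSq v a := by
  have h : star c * c = ((‖c‖ ^ 2 : ℝ) : ℂ) := by
    simpa using Complex.conj_mul' c
  unfold PositiveForm.normSq
  rw [star_smul, Matrix.mulVec_smul, smul_dotProduct, dotProduct_smul, smul_smul, h, smul_eq_mul,
    Complex.re_ofReal_mul]

theorem PositiveForm.pullbackDensity_comp {n : ℕ} (η : PositiveForm n) {f : ℂ → CP n} {h : ℂ → ℂ}
    {z : ℂ} {F : ℂ → Fin (n + 1) → ℂ} (hF : IsLocalLift f (h z) F) (hh : AnalyticAt ℂ h z) :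
    η.pullbackDensity (f ∘ h) z = ‖deriv h z‖ ^ 2 * η.pullbackDensity f (h z) := by
  rw [η.pullbackDensity_eq _ _ _ (hF.comp hh), η.pullbackDensity_eq _ _ _ hF,
    deriv.scomp z hF.1.differentiableAt hh.differentiableAt, η.normSq_smul_right]
  rfl

/-- The universal covering of the exterior of a disk by the unit disk, centred at `z`, with
`a = log (‖z‖ / r₀)`. -/
noncomputable def exteriorCovering (a : ℝ) (z w : ℂ) : ℂ :=
  z * Complex.exp (2 * a * (w / (1 - w)))

theorem one_sub_ne_zero_of_mem_ball {w : ℂ} (hw : w ∈ Metric.ball (0 : ℂ) 1) : 1 - w ≠ 0 := by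
  intro h
  rw [← sub_eq_zero.1 h] at hw
  simp at hw

theorem analyticAt_exteriorCovering (a : ℝ) (z : ℂ) {w : ℂ} (hw : w ∈ Metric.ball (0 : ℂ) 1) :
    AnalyticAt ℂ (exteriorCovering a z) w := by
  have := one_sub_ne_zero_of_mem_ball hw
  unfold exteriorCovering
  fun_prop (disch := assumption)

theorem deriv_exteriorCovering_zero (a : ℝ) (z : ℂ) :
    deriv (exteriorCovering a z) 0 = 2 * a * z := by
  have h1 : HasDerivAt (fun w : ℂ => w / (1 - w)) 1 0 := by
    have := (hasDerivAt_id' (0 : ℂ)).fun_div ((hasDerivAt_id' (0 : ℂ)).const_sub 1) (by simp)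
    simpa using this
  have := ((h1.const_mul (2 * a : ℂ)).cexp.const_mul z).deriv
  unfold exteriorCovering
  rw [this]
  simp
  ring

/-- The map `w / (1 - w)` is a Cayley transform of the disk to a half-plane. Scaling by `2 * a` with
`a = log (‖z‖ / r₀)` moves the boundary to real part `-a`, which `z * exp` sends to the circle of
radius `r₀`. -/
theorem neg_half_lt_re_div_one_sub {w : ℂ} (hw : w ∈ Metric.ball (0 : ℂ) 1) :
    -(1 / 2) < (w / (1 - w)).re := by
  have h1 : 0 < Complex.normSq (1 - w) := Complex.normSq_pos.2 (one_sub_ne_zero_of_mem_ball hw)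
  have h2 : Complex.normSq w < 1 := by
    rw [Complex.normSq_eq_norm_sq]
    have := mem_ball_zero_iff.1 hw
    nlinarith [norm_nonneg w]
  rw [Complex.div_re, ← add_div, lt_div_iff₀ h1]
  rw [Complex.normSq_apply] at h2 ⊢
  simp only [Complex.sub_re, Complex.one_re, Complex.sub_im, Complex.one_im]
  nlinarith

theorem exteriorCovering_mem {r₀ : ℝ} (hr₀ : 0 < r₀) {z : ℂ} (hz : r₀ < ‖z‖) {w : ℂ}
    (hw : w ∈ Metric.ball (0 : ℂ) 1) :
    r₀ < ‖exteriorCovering (Real.log (‖z‖ / r₀)) z w‖ := by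
  have hz0 : 0 < ‖z‖ := hr₀.trans hz
  have ha : 0 < Real.log (‖z‖ / r₀) := Real.log_pos ((one_lt_div hr₀).2 hz)
  set a := Real.log (‖z‖ / r₀) with haeq
  have hre : (2 * (a : ℂ) * (w / (1 - w))).re = 2 * a * (w / (1 - w)).re := by
    rw [← Complex.re_ofReal_mul]
    push_cast
    rfl
  rw [exteriorCovering, norm_mul, Complex.norm_exp, hre]
  have h1 : Real.exp (-a) < Real.exp (2 * a * (w / (1 - w)).re) :=
    Real.exp_lt_exp.2 (by nlinarith [neg_half_lt_re_div_one_sub hw])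
  calc r₀ = ‖z‖ * Real.exp (-a) := by
        rw [haeq, Real.exp_neg, Real.exp_log (by positivity)]
        field_simp
    _ < _ := mul_lt_mul_of_pos_left h1 hz0

/-- A curve in a hyperbolically imbedded set, defined outside a disk, is bounded in terms of the
Poincaré metric of the exterior of that disk. -/
theorem HyperbolicallyImbedded.exists_pullbackDensity_le_exterior {n : ℕ} {X Y : Set (CP n)}
    (hX : IsClosed X) (hYX : Y ⊆ X) (hY : HyperbolicallyImbedded Y X) {r₀ : ℝ} (hr₀ : 0 < r₀) :
    ∃ C : ℝ, 0 ≤ C ∧ ∀ f : ℂ → CP n, IsHolomorphicInto {z : ℂ | r₀ < ‖z‖} Y f →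
      ∀ z : ℂ, r₀ < ‖z‖ →
        (fubiniStudy n).pullbackDensity f z ≤ C / (‖z‖ ^ 2 * Real.log (‖z‖ / r₀) ^ 2) := by
  obtain ⟨C, hC, h⟩ := hY.exists_pullbackDensity_le hX hYX
  refine ⟨C, hC, fun f hf z hz => ?_⟩
  have hz0 : 0 < ‖z‖ := hr₀.trans hz
  have ha : 0 < Real.log (‖z‖ / r₀) := Real.log_pos ((one_lt_div hr₀).2 hz)
  set a := Real.log (‖z‖ / r₀) with haeq
  have hcov0 : exteriorCovering a z 0 = z := by simp [exteriorCovering]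
  obtain ⟨F, hF⟩ := hf.1 z hz
  rw [← hcov0] at hF
  -- The bound at the centre, applied to `f` composed with the covering; the derivative `2 * a * z`
  -- there yields `4 ‖z‖² a²` times the density of `f` at `z`.
  have hbd := h _ (hf.comp (fun w hw => analyticAt_exteriorCovering a z hw)
    (fun w hw => exteriorCovering_mem hr₀ hz hw))
  rw [(fubiniStudy n).pullbackDensity_comp hF
    (analyticAt_exteriorCovering a z (Metric.mem_ball_self one_pos)), hcov0,
    deriv_exteriorCovering_zero] at hbd
  have hn : ‖2 * (a : ℂ) * z‖ ^ 2 = 4 * (‖z‖ ^ 2 * a ^ 2) := by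
    rw [norm_mul, norm_mul, Complex.norm_real, Real.norm_of_nonneg ha.le, Complex.norm_two]
    ring
  rw [hn] at hbd
  rw [le_div_iff₀ (by positivity)]
  set δ := (fubiniStudy n).pullbackDensity f z
  -- Dropping the factor 4 needs `0 ≤ δ`; for `δ ≤ 0` the bound is trivial.
  rcases le_total δ 0 with h0 | h0
  · exact (mul_nonpos_of_nonpos_of_nonneg h0 (by positivity)).trans hC
  · have : 0 ≤ δ * (‖z‖ ^ 2 * a ^ 2) := by positivity
    linarith

/-! ### Integration -/

theorem integrableOn_inv_mul_log_sq {r₀ r₁ : ℝ} (hr₀ : 0 < r₀) (hr₁ : r₀ < r₁) :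
    IntegrableOn (fun s : ℝ => (s * Real.log (s / r₀) ^ 2)⁻¹) (Ioi r₁) := by
  have hlog {s : ℝ} (hs : r₁ ≤ s) : 0 < Real.log (s / r₀) :=
    Real.log_pos ((one_lt_div hr₀).2 (hr₁.trans_le hs))
  -- The antiderivative `-1 / log (s / r₀)` tends to 0 at infinity.
  refine integrableOn_Ioi_deriv_of_nonneg' (g := fun s => -(Real.log (s / r₀))⁻¹) (l := -0)
    (fun s hs => ?_) (fun s hs => ?_) ?_
  · have hs0 : 0 < s := (hr₀.trans hr₁).trans_le hs
    have := ((((hasDerivAt_id' s).div_const r₀).log (by positivity)).fun_inv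
      (hlog hs).ne').neg
    refine this.congr_deriv ?_
    have := (hlog hs).ne'
    field_simp
  · have hs0 : 0 < s := (hr₀.trans hr₁).trans hs
    positivity
  · exact ((Real.tendsto_log_atTop.comp (tendsto_id.atTop_div_const hr₀)).inv_tendsto_atTop).neg

theorem lintegral_poincare_exterior_lt_top {r₀ r₁ : ℝ} (hr₀ : 0 < r₀) (hr₁ : r₀ < r₁) (C : ℝ) :
    ∫⁻ z in {z : ℂ | r₁ < ‖z‖},
      ENNReal.ofReal (C / (‖z‖ ^ 2 * Real.log (‖z‖ / r₀) ^ 2)) < ⊤ := by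
  have hS : MeasurableSet {z : ℂ | r₁ < ‖z‖} := measurableSet_lt measurable_const measurable_norm
  rw [← lintegral_indicator hS, ← Complex.lintegral_comp_polarCoord_symm]
  set φ : ℝ → ℝ≥0∞ := (Ioi r₁).indicator fun s =>
    ENNReal.ofReal (C * (s * Real.log (s / r₀) ^ 2)⁻¹) with hφ
  have hφm : Measurable φ := by
    refine Measurable.indicator ?_ measurableSet_Ioi
    fun_prop
  -- The polar Jacobian `s` cancels one factor of `s²`, leaving `1 / (s log² (s / r₀))`, independent
  -- of the angle.
  calc _ ≤ ∫⁻ p in Ioi (0 : ℝ) ×ˢ Ioo (-Real.pi) Real.pi, φ p.1 := by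
        rw [polarCoord_target]
        refine setLIntegral_mono' (measurableSet_Ioi.prod measurableSet_Ioo) fun p hp => ?_
        have hp0 : 0 < p.1 := hp.1
        have hn : ‖Complex.polarCoord.symm p‖ = p.1 := by
          rw [Complex.norm_polarCoord_symm, abs_of_pos hp0]
        by_cases h : r₁ < p.1
        · have hm : Complex.polarCoord.symm p ∈ {z : ℂ | r₁ < ‖z‖} := by
            rw [mem_ofPred_eq, hn]; exact h
          rw [indicator_of_mem hm, hφ, indicator_of_mem (mem_Ioi.2 h), smul_eq_mul, hn,
            ← ENNReal.ofReal_mul hp0.le]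
          refine le_of_eq (congrArg _ ?_)
          rw [div_eq_mul_inv, mul_inv, mul_inv]
          field_simp
        · have hm : Complex.polarCoord.symm p ∉ {z : ℂ | r₁ < ‖z‖} := by
            rw [mem_ofPred_eq, hn]; exact h
          rw [indicator_of_notMem hm]
          simp
    _ = volume (Ioo (-Real.pi) Real.pi) * ∫⁻ s in Ioi (0 : ℝ), φ s := by
        rw [Measure.volume_eq_prod, ← Measure.prod_restrict, lintegral_prod _ (by fun_prop)]
        simp [mul_comm, lintegral_const_mul _ hφm]
    _ < ⊤ := by
        refine ENNReal.mul_lt_top (by simp) ?_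
        refine (setLIntegral_le_lintegral _ _).trans_lt ?_
        rw [hφ, lintegral_indicator measurableSet_Ioi]
        exact ((integrableOn_inv_mul_log_sq hr₀ hr₁).const_mul C).lintegral_lt_top

theorem lintegral_div_ofReal_Ioo_le (K : ℝ) {r₁ r : ℝ} (hr₁ : 0 < r₁) (hr : r₁ < r) :
    ∫⁻ t in Ioo r₁ r, ENNReal.ofReal K / ENNReal.ofReal t ≤
      ENNReal.ofReal K * ENNReal.ofReal (Real.log (r / r₁)) := by
  have hint : IntegrableOn (fun t : ℝ => t⁻¹) (Ioc r₁ r) := by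
    rw [← intervalIntegrable_iff_integrableOn_Ioc_of_le hr.le]
    exact intervalIntegral.intervalIntegrable_inv
      (fun t ht => by rw [uIcc_of_le hr.le] at ht; exact (hr₁.trans_le ht.1).ne') continuousOn_id
  have hlog : ∫⁻ t in Ioc r₁ r, ENNReal.ofReal t⁻¹ = ENNReal.ofReal (Real.log (r / r₁)) := by
    rw [← integral_inv_of_pos hr₁ (hr₁.trans hr), intervalIntegral.integral_of_le hr.le,
      ofReal_integral_eq_lintegral_ofReal hint]
    filter_upwards [ae_restrict_mem measurableSet_Ioc] with t ht
    exact inv_nonneg.2 (hr₁.trans ht.1).le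
  calc _ = ∫⁻ t in Ioo r₁ r, ENNReal.ofReal K * ENNReal.ofReal t⁻¹ := by
        refine setLIntegral_congr_fun measurableSet_Ioo fun t ht => ?_
        rw [div_eq_mul_inv, ENNReal.ofReal_inv_of_pos (hr₁.trans ht.1)]
    _ = ENNReal.ofReal K * ∫⁻ t in Ioo r₁ r, ENNReal.ofReal t⁻¹ :=
        lintegral_const_mul _ (by fun_prop)
    _ ≤ _ := by
        rw [← hlog]
        gcongr
        exact Ioo_subset_Ioc_self

theorem LeExcBigOLog.of_le_mul_log {T : ℝ → ℝ≥0∞} {r₁ : ℝ} (hr₁ : 0 < r₁) {K : ℝ} (hK : 0 ≤ K)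
    (hT : ∀ r, r₁ < r → T r ≤ ENNReal.ofReal K * ENNReal.ofReal (Real.log (r / r₁))) :
    LeExcBigOLog T r₁ := by
  -- For `r > 1 / r₁` one has `-log r₁ < log r`, hence `log (r / r₁) ≤ 2 log r`. The exceptional set
  -- thus lies in `(r₁, 1 / r₁]`, which is empty when `r₁ ≥ 1`.
  refine ⟨2 * K, ne_top_of_le_ne_top (measure_Ioc_lt_top (a := r₁) (b := r₁⁻¹)).ne
    (measure_mono ?_)⟩
  rintro r ⟨hr, hTr⟩
  refine ⟨hr, le_of_not_gt fun h => hTr ((hT r hr).trans ?_)⟩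
  rw [← ENNReal.ofReal_mul hK]
  refine ENNReal.ofReal_le_ofReal ?_
  have h1 : -Real.log r₁ < Real.log r := by
    rw [← Real.log_inv]
    exact Real.log_lt_log (inv_pos.2 hr₁) h
  rw [Real.log_div (hr₁.trans hr).ne' hr₁.ne']
  nlinarith

theorem theorem2p2 {n : ℕ} (X : ProjectiveVariety n) (D : EffectiveCartierDivisor X)
    (hD : HyperbolicallyImbedded D.compl X.carrier) :
    QuantitativelyBigPicard D := by
  intro r₀ hr₀ f hf
  obtain ⟨C, -, hC⟩ := hD.exists_pullbackDensity_le_exterior X.closed.isClosed sdiff_subset hr₀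
  refine ⟨fubiniStudy n, fun r₁ hr₁ => ?_⟩
  have hr₁0 := hr₀.trans hr₁
  have hK := lintegral_poincare_exterior_lt_top hr₀ hr₁ C
  refine LeExcBigOLog.of_le_mul_log hr₁0 (ENNReal.toReal_nonneg (a := ∫⁻ z in {z : ℂ | r₁ < ‖z‖},
    ENNReal.ofReal (C / (‖z‖ ^ 2 * Real.log (‖z‖ / r₀) ^ 2)))) fun r hr =>
    le_trans ?_ (lintegral_div_ofReal_Ioo_le _ hr₁0 hr)
  refine lintegral_mono fun t => ?_
  rw [ENNReal.ofReal_toReal hK.ne]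
  refine ENNReal.div_le_div_right ?_ _
  -- The annulus is enlarged to the whole exterior, which makes the bound independent of `t`.
  refine (lintegral_mono_set (t := {z : ℂ | r₁ < ‖z‖}) fun z hz => hz.1).trans ?_
  exact setLIntegral_mono' (measurableSet_lt measurable_const measurable_norm) fun z hz =>
    ENNReal.ofReal_le_ofReal (hC f hf z (hr₁.trans hz))
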